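/- Let $p>3$ be a prime. For a rational number $\alpha$ that is a $p$-adic unit with expansion $\alpha=\alpha_0+\alpha_1p+\alpha_2p^2+\cdots$, $0\le\alpha_i\le p-1$, let $[\alpha]_s=\alpha_0+\alpha_1p+\dots+\alpha_{s-1}p^{s-1}$. For $s\ge 0$ define the polynomial $$\bar Q_s(x)={}_2F_1\Big(-\big[-\tfrac23\big]_s,\,-\big[-\tfrac13\big]_s;\,1;\,x\Big)=\sum_{k\ge0}\binom{[-2/3]_s}{k}\binom{[-1/3]_s}{k}x^k ,$$ and put $\mathfrak D=\{x\in\mathbb Z_p : |\bar Q_1(x)|_p=1\}$. Then: 1. For every $s\ge1$ the rational function $\bar Q_{s+1}(x)/\bar Q_s(x^p)$ is regular on $\mathfrak D$, that is, $\bar Q_s(x^p)\ne0$ for all $x\in\mathfrak D$. 2. The sequence $\big(\bar Q_{s+1}(x)/\bar Q_s(x^p)\big)_{s\ge1}$ converges uniformly on $\mathfrak D$ to a function $f:\mathfrak D\to\mathbb Q_p$. The limit $f$ is analytic: for each $a\in\mathfrak D$ the disc $\{x\in\mathbb Z_p: |x-a|_p<1\}$ is contained in $\mathfrak D$, and on it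 $f$ is the sum of a power series in $x-a$ over $\mathbb Q_p$ with radius of convergence at least $1$. 3. The disc $D_{0,1}=\{x\in\mathbb Z_p: |x|_p<1\}$ is contained in $\mathfrak D$; the power series $F(x)={}_2F_1(2/3,1/3;1;x)=\sum_{k\ge0}\binom{-1/3}{k}\binom{-2/3}{k}x^k$ converges on $D_{0,1}$, $F(x^p)\neq0$ there, and $f(x)=F(x)/F(x^p)$ for all $x\in D_{0,1}$. -/

import Mathlib

/-- For a rational number `q` that is a `p`-adic integer with expansion
`q = q₀ + q₁ p + q₂ p² + ⋯`, `0 ≤ qᵢ < p`, the natural number `[q]_s = q₀ + q₁ p + ⋯ + q_{s-1} p^{s-1}`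
(`PadicInt.appr` is this partial sum). Rationals that are not `p`-adic integers get the value `0`. -/
noncomputable def padicTrunc (p : ℕ) [Fact p.Prime] (q : ℚ) (s : ℕ) : ℕ :=
  if h : ‖(q : ℚ_[p])‖ ≤ 1 then PadicInt.appr ⟨(q : ℚ_[p]), h⟩ s else 0

/-- The polynomial `₂F₁(-m, -n; 1; X)`, the terminating hypergeometric series. -/
noncomputable def hypergeometricPoly (p : ℕ) [Fact p.Prime] (m n : ℕ) : Polynomial ℚ_[p] :=
  ∑ k ∈ Finset.range (m + 1),
    Polynomial.C (ordinaryHypergeometricCoefficient (-(m : ℚ_[p])) (-(n : ℚ_[p])) 1 k) *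
      Polynomial.X ^ k

/-- The polynomial `hypergeometricPoly p m n` is the hypergeometric function `₂F₁(-m, -n; 1; x)`. -/
theorem hypergeometricPoly_eval (p : ℕ) [Fact p.Prime] (m n : ℕ) (x : ℚ_[p]) :
    (hypergeometricPoly p m n).eval x = ₂F₁ (-(m : ℚ_[p])) (-(n : ℚ_[p])) 1 x := by
  rw [ordinaryHypergeometric, ordinaryHypergeometric_sum_eq,
    tsum_eq_sum (s := Finset.range (m + 1)) ?_]
  · simp [hypergeometricPoly, Polynomial.eval_finsetSum]
  · intro k hk
    have hk' : m < k := by simpa using hk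
    have h0 : (ascPochhammer ℚ_[p] k).eval (-(m : ℚ_[p])) = 0 :=
      (ascPochhammer_eval_eq_zero_iff k _).2 ⟨m, hk', by simp⟩
    simp [h0]

/-- The approximation polynomial `Q̄_s(x) = ₂F₁(-[-2/3]_s, -[-1/3]_s; 1; x)`. -/
noncomputable def Qbar (p : ℕ) [Fact p.Prime] (s : ℕ) : Polynomial ℚ_[p] :=
  hypergeometricPoly p (padicTrunc p (-2 / 3) s) (padicTrunc p (-1 / 3) s)

/-- The domain `D = {x ∈ ℤ_p : |Q̄₁(x)|_p = 1}`, as a subset of `ℚ_p`. -/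
def domainD (p : ℕ) [Fact p.Prime] : Set ℚ_[p] :=
  {x | ‖x‖ ≤ 1 ∧ ‖(Qbar p 1).eval x‖ = 1}

/-- The function `F(x) = ₂F₁(2/3, 1/3; 1; x)` on the open unit disc. -/
noncomputable def hyperF (p : ℕ) [Fact p.Prime] (x : ℚ_[p]) : ℚ_[p] :=
  ₂F₁ (2 / 3 : ℚ_[p]) (1 / 3 : ℚ_[p]) 1 x

/-! Everything rests on the Dwork congruence Q_{c+1}(x) Q_s(x^p) ≡ Q_{s+1}(x) Q_c(x^p) mod p^{c+1}
for c ≤ s, an identity of integral polynomials (`dwork_congruence_intQbar`).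

To obtain it, Q_s is written as the constant term in t of (1 + xt)^a (1 + 1/t)^b, and a, b are split
into base-p digits, so that the Laurent polynomial becomes a product of p-power powers of digit
factors Λ_j. For the Frobenius lift σ : t ↦ t^p, x ↦ x^p one has Λ^p ≡ σΛ mod p. Trading powers for
twists by σ, with controlled p-divisible errors, gives a recursion for constant terms whose
coefficients do not depend on the starting index (`exists_constantTerm_recursion`); induction on 2×2
determinants then yields the congruence. Removing the lowest digit of -1/3 and -2/3 fixes or swaps
the two numbers, so shifted blocks again give Q_s.

On the domain, the case c = 0 and z^p ≡ z mod p make all values Q_s(z), Q_s(z^p) units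
(`padicQbar_eval_isUnit`). The congruence thus bounds differences of ratios uniformly. Around a
point of the domain the ratios are power series over ℤ_p satisfying the same congruences, so their
coefficients converge and the limit is analytic. On the open unit disc Q_s → F by dominated
convergence, which identifies the limit. -/

/-! ### Dwork congruences in a ring with a Frobenius lift -/

section GhostExpansion

variable {L R : Type*} [CommRing L] [CommRing R]

/-- `f` is the `i`-th Frobenius twist of an element divisible by `p ^ n`. -/
def IsTwist (p : ℕ) (σ : L →+* L) (i n : ℕ) (f : L) : Prop :=
  ∃ u, f = σ^[i] ((p : L) ^ n * u)

theorem iterate_natCast_pow_mul (p : ℕ) (σ : L →+* L) (i n : ℕ) (u : L) :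
    σ^[i] ((p : L) ^ n * u) = (p : L) ^ n * σ^[i] u := by
  rw [iterate_map_mul, iterate_map_pow,
    Function.iterate_fixed (map_natCast σ p)]

theorem IsTwist.add {p : ℕ} {σ : L →+* L} {i n : ℕ} {f g : L} (hf : IsTwist p σ i n f)
    (hg : IsTwist p σ i n g) : IsTwist p σ i n (f + g) := by
  obtain ⟨u, rfl⟩ := hf
  obtain ⟨v, rfl⟩ := hg
  exact ⟨u + v, by rw [mul_add, iterate_map_add]⟩

theorem IsTwist.mul {p : ℕ} {σ : L →+* L} {i m n : ℕ} {f g : L} (hf : IsTwist p σ i m f)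
    (hg : IsTwist p σ i n g) : IsTwist p σ i (m + n) (f * g) := by
  obtain ⟨u, rfl⟩ := hf
  obtain ⟨v, rfl⟩ := hg
  exact ⟨u * v, by rw [← iterate_map_mul]; congr 1; ring⟩

theorem IsTwist.of_le {p : ℕ} {σ : L →+* L} {i j m n : ℕ} {f : L} (hf : IsTwist p σ j n f)
    (hi : i ≤ j) (hm : m ≤ n) : IsTwist p σ i m f := by
  obtain ⟨u, rfl⟩ := hf
  obtain ⟨a, rfl⟩ := Nat.exists_eq_add_of_le hi
  obtain ⟨b, rfl⟩ := Nat.exists_eq_add_of_le hm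
  refine ⟨(p : L) ^ b * σ^[a] u, ?_⟩
  rw [Function.iterate_add_apply, iterate_natCast_pow_mul, pow_add, mul_assoc]

/-- The product `σⁱ(Λᵢ Λᵢ₊₁ᵖ ⋯ Λ_{c-1}^{p^{c-1-i}})`. -/
def blockProd (p : ℕ) (σ : L →+* L) (Λ : ℕ → L) (i c : ℕ) : L :=
  ∏ j ∈ Finset.Ico i c, σ^[i] (Λ j ^ p ^ (j - i))

theorem blockProd_succ (p : ℕ) (σ : L →+* L) (Λ : ℕ → L) {i c : ℕ} (h : i ≤ c) :
    blockProd p σ Λ i (c + 1) = blockProd p σ Λ i c * σ^[i] (Λ c ^ p ^ (c - i)) :=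
  Finset.prod_Ico_succ_top h _

/-- Raising f^p ≡ σf mod p to the power p^m improves the modulus to p^{m+1}; σ^i is then applied. -/
theorem isTwist_ghost {p : ℕ} {σ : L →+* L} {f : L} (hf : (p : L) ∣ f ^ p - σ f) {i c : ℕ}
    (hi : i < c) :
    IsTwist p σ i (c - i) (σ^[i] (f ^ p ^ (c - i)) - σ^[i + 1] (f ^ p ^ (c - (i + 1)))) := by
  obtain ⟨m, rfl⟩ := Nat.exists_eq_add_of_lt hi
  obtain ⟨u, hu⟩ := dvd_sub_pow_of_dvd_sub hf m
  have h1 : i + m + 1 - i = m + 1 := by omega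
  have h2 : i + m + 1 - (i + 1) = m := by omega
  refine ⟨u, ?_⟩
  rw [h1, h2, ← hu, Function.iterate_succ_apply, ← iterate_map_sub, map_pow, ← pow_mul, pow_succ']

theorem natCast_pow_dvd_map (p n : ℕ) (ct : L →+ R) (u : L) :
    (p : R) ^ n ∣ ct ((p : L) ^ n * u) := by
  refine ⟨ct u, ?_⟩
  have := map_nsmul ct (p ^ n) u
  simpa [nsmul_eq_mul] using this

/-- Expansion of the constant terms `ct (B i c * T i)` along the chain of twists. -/
theorem exists_ghost_expansion {p : ℕ} {σ : L →+* L} {τ : R →+* R} {ct : L →+ R} {Λ : ℕ → L}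
    (hΛ : ∀ j, (p : L) ∣ Λ j ^ p - σ (Λ j))
    (hct : ∀ i c g, i ≤ c →
      ct (blockProd p σ Λ i c * σ^[c] g) = ct (blockProd p σ Λ i c) * τ^[c] (ct g))
    (c : ℕ) : ∀ (k : ℕ) (T : ℕ → L),
      (∀ i < c, IsTwist p σ i (k + (c - i)) (T i - T (i + 1))) → IsTwist p σ c k (T c) →
      ∃ J : ℕ → R, (∀ d ≤ c, (p : R) ^ (k + (c - d)) ∣ J d) ∧
        ∀ i ≤ c, ct (blockProd p σ Λ i c * T i) =
          ∑ d ∈ Finset.Icc i c, ct (blockProd p σ Λ i d) * J d := by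
  -- A σ^c-twist leaves the constant term as a factor that is the same for every i.
  have last : ∀ (c k : ℕ) (f : L), IsTwist p σ c k f → ∃ r : R, (p : R) ^ k ∣ r ∧
      ∀ i ≤ c, ct (blockProd p σ Λ i c * f) = ct (blockProd p σ Λ i c) * r := by
    rintro c k _ ⟨u, rfl⟩
    refine ⟨τ^[c] (ct ((p : L) ^ k * u)), ?_, fun i hi => hct i c _ hi⟩
    obtain ⟨v, hv⟩ := natCast_pow_dvd_map p k ct u
    exact ⟨τ^[c] v, by rw [hv, iterate_natCast_pow_mul]⟩
  induction c with
  | zero =>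
    intro k T _ h0
    obtain ⟨r, hr, h⟩ := last 0 k _ h0
    refine ⟨fun _ => r, fun d _ => ?_, fun i hi => ?_⟩
    · simpa using hr
    · obtain rfl : i = 0 := by omega
      simpa using h 0 le_rfl
  | succ c ih =>
    intro k T hT hc
    obtain ⟨r, hr, h⟩ := last (c + 1) k _ hc
    -- Telescoping: the weakest difference, T c - T (c + 1), is already divisible by p^{k+1}.
    have tail : ∀ m ≤ c, IsTwist p σ (c - m) (k + 1) (T (c - m) - T (c + 1)) := by
      intro m
      induction m with
      | zero => exact fun _ => (hT c (by omega)).of_le le_rfl (by omega)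
      | succ m ihm =>
        intro hm
        have e : c - (m + 1) + 1 = c - m := by omega
        have h1 := (hT (c - (m + 1)) (by omega)).of_le le_rfl
          (show k + 1 ≤ k + (c + 1 - (c - (m + 1))) by omega)
        rw [e] at h1
        have h2 := (ihm (by omega)).of_le (show c - (m + 1) ≤ c - m by omega) le_rfl
        simpa using h1.add h2
    have tail' : ∀ i ≤ c, IsTwist p σ i (k + 1) (T i - T (c + 1)) := by
      intro i hi
      have := tail (c - i) (by omega)
      rwa [show c - (c - i) = i by omega] at this
    set S : ℕ → L := fun i => σ^[i] (Λ c ^ p ^ (c - i)) with hS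
    have hS0 : ∀ i, IsTwist p σ i 0 (S i) := fun i => ⟨Λ c ^ p ^ (c - i), by simp [hS]⟩
    -- Once T (c + 1) is split off, the last factor S i of the block joins the chain. The product
    -- rule (S i - S (i+1))(T i - T (c+1)) + S (i+1)(T i - T (i+1)) gives the divisibility needed
    -- with k + 1 in place of k.
    obtain ⟨J, hJ, hJsum⟩ := ih (k + 1) (fun i => S i * (T i - T (c + 1))) (by
      intro i hi
      have h1 := (isTwist_ghost (hΛ c) hi).mul (tail' i hi.le)
      have h2 := ((hS0 (i + 1)).of_le (Nat.le_succ i) le_rfl).mul (hT i (by omega))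
      have h3 := (h1.of_le le_rfl (show k + 1 + (c - i) ≤ _ by omega)).add
        (h2.of_le le_rfl (show k + 1 + (c - i) ≤ _ by omega))
      convert h3 using 1
      simp only [hS]
      ring) (by simpa using (hS0 c).mul (tail' c le_rfl))
    refine ⟨fun d => if d = c + 1 then r else J d, fun d hd => ?_, fun i hi => ?_⟩
    · rcases Nat.lt_or_ge c d with h' | h'
      · obtain rfl : d = c + 1 := by omega
        simpa using hr
      · simp only [if_neg (show d ≠ c + 1 by omega)]
        convert hJ d h' using 2
        omega
    · rcases Nat.lt_or_ge c i with h' | h'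
      · obtain rfl : i = c + 1 := by omega
        simpa using h (c + 1) le_rfl
      · rw [Finset.sum_Icc_succ_top (by omega)]
        simp only [if_true]
        rw [← h i hi]
        have e : ∑ d ∈ Finset.Icc i c, ct (blockProd p σ Λ i d) * (if d = c + 1 then r else J d)
            = ∑ d ∈ Finset.Icc i c, ct (blockProd p σ Λ i d) * J d := by
          refine Finset.sum_congr rfl fun d hd => ?_
          rw [if_neg (by have := (Finset.mem_Icc.1 hd).2; omega)]
        rw [e, ← hJsum i h', ← map_add, blockProd_succ p σ Λ h']
        congr 1
        simp only [hS]
        ring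

/-- The last factors of the blocks, as i varies, form a chain of the kind just expanded. What
matters is that one J serves all i. -/
theorem exists_constantTerm_recursion {p : ℕ} {σ : L →+* L} {τ : R →+* R} {ct : L →+ R}
    {Λ : ℕ → L} (hΛ : ∀ j, (p : L) ∣ Λ j ^ p - σ (Λ j))
    (hct : ∀ i c g, i ≤ c →
      ct (blockProd p σ Λ i c * σ^[c] g) = ct (blockProd p σ Λ i c) * τ^[c] (ct g))
    (c : ℕ) : ∃ J : ℕ → R, (∀ d ≤ c, (p : R) ^ (c - d) ∣ J d) ∧
      ∀ i ≤ c, ct (blockProd p σ Λ i (c + 1)) =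
        ∑ d ∈ Finset.Icc i c, ct (blockProd p σ Λ i d) * J d := by
  obtain ⟨J, hJ, hsum⟩ := exists_ghost_expansion hΛ hct c 0 (fun i => σ^[i] (Λ c ^ p ^ (c - i)))
    (fun i hi => by simpa using isTwist_ghost (hΛ c) hi) ⟨Λ c, by simp⟩
  exact ⟨J, by simpa using hJ, fun i hi => by rw [blockProd_succ p σ Λ hi, hsum i hi]⟩

/-- Dwork congruences for constant terms. -/
theorem dwork_congruence_constantTerm {p : ℕ} {σ : L →+* L} {τ : R →+* R} {ct : L →+ R}
    {Λ : ℕ → L} (hΛ : ∀ j, (p : L) ∣ Λ j ^ p - σ (Λ j))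
    (hct : ∀ i c g, i ≤ c →
      ct (blockProd p σ Λ i c * σ^[c] g) = ct (blockProd p σ Λ i c) * τ^[c] (ct g))
    (s : ℕ) : ∀ c, 1 ≤ c → c ≤ s →
      (p : R) ^ c ∣ ct (blockProd p σ Λ 0 c) * ct (blockProd p σ Λ 1 s) -
        ct (blockProd p σ Λ 0 s) * ct (blockProd p σ Λ 1 c) := by
  induction s using Nat.strong_induction_on with
  | _ s ih =>
  intro c hc hcs
  rcases hcs.eq_or_lt with rfl | hlt
  · simp
  obtain ⟨n, rfl⟩ : ∃ n, s = n + 1 := ⟨s - 1, by omega⟩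
  obtain ⟨J, hJ, hsum⟩ := exists_constantTerm_recursion hΛ hct n
  rw [hsum 0 (by omega), hsum 1 (by omega)]
  set W : ℕ → ℕ → R := fun i d => ct (blockProd p σ Λ i d) with hW
  change (p : R) ^ c ∣ W 0 c * ∑ d ∈ Finset.Icc 1 n, W 1 d * J d -
    (∑ d ∈ Finset.Icc 0 n, W 0 d * J d) * W 1 c
  -- The common J turns the difference into smaller determinants; only d = 0 is unmatched, and J 0
  -- is divisible by p^n with n ≥ c.
  have e : W 0 c * ∑ d ∈ Finset.Icc 1 n, W 1 d * J d -
      (∑ d ∈ Finset.Icc 0 n, W 0 d * J d) * W 1 c =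
      ∑ d ∈ Finset.Icc 1 n, (W 0 c * W 1 d - W 0 d * W 1 c) * J d - W 0 0 * J 0 * W 1 c := by
    have : ∑ d ∈ Finset.Icc 0 n, W 0 d * J d =
        W 0 0 * J 0 + ∑ d ∈ Finset.Icc 1 n, W 0 d * J d :=
      (Finset.add_sum_Ioc_eq_sum_Icc (f := fun d => W 0 d * J d) (Nat.zero_le n)).symm
    rw [this, Finset.mul_sum, add_mul, Finset.sum_mul, ← sub_sub, sub_right_comm,
      ← Finset.sum_sub_distrib]
    congr 1
    exact Finset.sum_congr rfl fun d _ => by ring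
  rw [e]
  refine dvd_sub (Finset.dvd_sum fun d hd => ?_) ?_
  · obtain ⟨hd1, hdn⟩ := Finset.mem_Icc.1 hd
    rcases le_or_gt c d with h | h
    · exact (ih d (by omega) c hc h).mul_right _
    -- For d < c the determinant supplies only p^d; J d supplies the missing p^{n-d}.
    · refine (pow_dvd_pow _ (show c ≤ d + (n - d) by omega)).trans ?_
      rw [pow_add]
      refine mul_dvd_mul ?_ (hJ d hdn)
      rw [← neg_sub, dvd_neg]
      exact ih c (by omega) d hd1 h.le
  · refine Dvd.dvd.mul_right (Dvd.dvd.mul_left ?_ _) _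
    exact (pow_dvd_pow _ (by omega)).trans (hJ 0 (by omega))

end GhostExpansion

/-! ### Binomial polynomials as constant terms -/

section LaurentSetup

open Polynomial in
/-- The polynomial `∑ₖ C(a,k) C(b,k) Xᵏ` with integer coefficients. -/
noncomputable def choosePoly (a b : ℕ) : ℤ[X] :=
  ∑ k ∈ Finset.range (a + 1), ((a.choose k * b.choose k : ℕ) : ℤ[X]) * X ^ k

theorem choosePoly_coeff (a b k : ℕ) :
    (choosePoly a b).coeff k = ((a.choose k * b.choose k : ℕ) : ℤ) := by
  simp only [choosePoly, Polynomial.finsetSum_coeff, Polynomial.coeff_natCast_mul,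
    Polynomial.coeff_X_pow, mul_ite, mul_one, mul_zero]
  rw [Finset.sum_ite_eq]
  split_ifs with h
  · rfl
  · rw [Nat.choose_eq_zero_of_lt (by simpa [Nat.lt_succ_iff] using h)]
    simp

theorem choosePoly_comm (a b : ℕ) : choosePoly a b = choosePoly b a := by
  ext k
  rw [choosePoly_coeff, choosePoly_coeff, mul_comm]

open Polynomial in
theorem expand_choosePoly (q a b : ℕ) : expand ℤ q (choosePoly a b) =
    ∑ k ∈ Finset.range (a + 1), ((a.choose k * b.choose k : ℕ) : ℤ[X]) * (X ^ q) ^ k := by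
  simp [choosePoly]

-- The t-exponents of the two powers lie strictly between -qN and qN, so a shift by qNm can reach
-- exponent 0 only if m = 0; then the indices of the two binomial sums must agree.
open AddMonoidAlgebra in
theorem coeff_zero_one_add_pow_mul {R : Type*} [CommRing R] {a b q N : ℕ} (hq : 0 < q)
    (ha : a < N) (hb : b < N) (x r : R) (m : ℤ) :
    ((1 + single (q : ℤ) x) ^ a * (1 + single (-(q : ℤ)) 1) ^ b *
      single (q * N * m) r : AddMonoidAlgebra R ℤ).coeff 0 =
    if m = 0 then (∑ k ∈ Finset.range (a + 1), ((a.choose k * b.choose k : ℕ) : R) * x ^ k) * r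
      else 0 := by
  have hpow : ∀ (n : ℕ) (z : ℤ) (y : R), (1 + single z y : AddMonoidAlgebra R ℤ) ^ n =
      ∑ k ∈ Finset.range (n + 1), single (k * z) ((n.choose k : R) * y ^ k) := by
    intro n z y
    rw [add_comm, add_pow]
    refine Finset.sum_congr rfl fun k _ => ?_
    have hc : ((n.choose k : ℕ) : AddMonoidAlgebra R ℤ) = single 0 (n.choose k : R) :=
      (map_natCast (singleZeroRingHom (R := R) (M := ℤ)) _).symm
    rw [one_pow, mul_one, single_pow, hc, single_mul_single, nsmul_eq_mul, add_zero,
      mul_comm (y ^ k)]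
  have key : ∀ k ∈ Finset.range (a + 1), ∀ l ∈ Finset.range (b + 1),
      ((k : ℤ) * q + l * -(q : ℤ) + q * N * m = 0 ↔ m = 0 ∧ k = l) := by
    intro k hk l hl
    rw [Finset.mem_range] at hk hl
    have hq' : (q : ℤ) ≠ 0 := by positivity
    constructor
    · intro h
      have h1 : (q : ℤ) * ((k : ℤ) - l + N * m) = 0 := by linarith
      have h2 := (mul_eq_zero.1 h1).resolve_left hq'
      have hm : m = 0 := by
        by_contra hm
        rcases lt_or_gt_of_ne hm with h | h
        · have : (N : ℤ) * m ≤ N * (-1) := by gcongr; omega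
          omega
        · have : (N : ℤ) * 1 ≤ N * m := by gcongr; omega
          omega
      subst hm
      refine ⟨rfl, ?_⟩
      simp at h2
      omega
    · rintro ⟨rfl, rfl⟩
      ring
  rw [hpow, hpow, Finset.sum_mul_sum, Finset.sum_mul]
  simp only [Finset.sum_mul, single_mul_single, coeff_sum, Finsupp.finsetSum_apply, coeff_single,
    Finsupp.single_apply]
  rw [Finset.sum_congr rfl fun k hk => Finset.sum_congr rfl fun l hl =>
    if_congr (key k hk l hl) rfl rfl]
  split_ifs with hm
  · simp only [hm, true_and]
    refine Finset.sum_congr rfl fun k hk => ?_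
    rw [Finset.sum_ite_eq]
    split_ifs with hk'
    · push_cast
      ring
    · rw [Nat.choose_eq_zero_of_lt (n := b) (by simpa [Nat.lt_succ_iff] using hk')]
      simp
  · simp [hm]

end LaurentSetup

/-! ### The Frobenius lift and congruences for binomial polynomials -/

section LaurentFrobenius

open AddMonoidAlgebra Polynomial

/-- The Frobenius lift `t ↦ tᵖ`, `x ↦ xᵖ` on `ℤ[x][t, t⁻¹]`. -/
noncomputable def laurentFrobenius (p : ℕ) : AddMonoidAlgebra ℤ[X] ℤ →+* AddMonoidAlgebra ℤ[X] ℤ :=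
  (mapDomainRingHom ℤ[X] (AddMonoidHom.mulLeft (p : ℤ))).comp
    (mapRingHom ℤ (expand ℤ p : ℤ[X] →+* ℤ[X]))

theorem laurentFrobenius_single (p : ℕ) (z : ℤ) (r : ℤ[X]) :
    laurentFrobenius p (single z r) = single (p * z) (expand ℤ p r) := by
  rw [laurentFrobenius, RingHom.comp_apply, mapRingHom_single, mapDomainRingHom_apply,
    mapDomain_single]
  rfl

theorem laurentFrobenius_iterate_single (p i : ℕ) (z : ℤ) (r : ℤ[X]) :
    (laurentFrobenius p)^[i] (single z r) = single ((p : ℤ) ^ i * z) (expand ℤ (p ^ i) r) := by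
  induction i with
  | zero => simp
  | succ i ih =>
    rw [Function.iterate_succ_apply', ih, laurentFrobenius_single, expand_expand, pow_succ',
      pow_succ', mul_assoc]

/-- The constant term with respect to `t`. -/
noncomputable def laurentConstantTerm : AddMonoidAlgebra ℤ[X] ℤ →+ ℤ[X] where
  toFun f := f.coeff 0
  map_zero' := rfl
  map_add' _ _ := rfl

/-- The Laurent polynomial `(1 + x t)ᵃ (1 + t⁻¹)ᵇ`, with constant term `∑ₖ C(a,k) C(b,k) xᵏ`. -/
noncomputable def chooseLaurent (a b : ℕ) : AddMonoidAlgebra ℤ[X] ℤ :=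
  (1 + single 1 X) ^ a * (1 + single (-1) 1) ^ b

theorem natCast_dvd_pow_sub_map_mul {L : Type*} [CommRing L] {p : ℕ} {σ : L →+* L} {f g : L}
    (hf : (p : L) ∣ f ^ p - σ f) (hg : (p : L) ∣ g ^ p - σ g) :
    (p : L) ∣ (f * g) ^ p - σ (f * g) := by
  have e : (f * g) ^ p - σ (f * g) = f ^ p * (g ^ p - σ g) + (f ^ p - σ f) * σ g := by
    rw [map_mul]; ring
  rw [e]
  exact dvd_add (hg.mul_left _) (hf.mul_right _)

theorem natCast_dvd_pow_sub_map_pow {L : Type*} [CommRing L] {p : ℕ} {σ : L →+* L} {f : L}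
    (hf : (p : L) ∣ f ^ p - σ f) (n : ℕ) : (p : L) ∣ (f ^ n) ^ p - σ (f ^ n) := by
  induction n with
  | zero => simp
  | succ n ih => rw [pow_succ]; exact natCast_dvd_pow_sub_map_mul ih hf

theorem natCast_dvd_one_add_pow_sub_map {L : Type*} [CommRing L] {p : ℕ} (hp : p.Prime)
    {σ : L →+* L} {f : L} (hf : σ f = f ^ p) : (p : L) ∣ (1 + f) ^ p - σ (1 + f) := by
  obtain ⟨r, hr⟩ := exists_add_pow_prime_eq hp 1 f
  refine ⟨f * r, ?_⟩
  rw [hr, map_add, map_one, hf]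
  ring

theorem natCast_dvd_chooseLaurent_pow_sub {p : ℕ} (hp : p.Prime) (a b : ℕ) :
    (p : AddMonoidAlgebra ℤ[X] ℤ) ∣
      chooseLaurent a b ^ p - laurentFrobenius p (chooseLaurent a b) := by
  refine natCast_dvd_pow_sub_map_mul
    (natCast_dvd_pow_sub_map_pow (natCast_dvd_one_add_pow_sub_map hp ?_) a)
    (natCast_dvd_pow_sub_map_pow (natCast_dvd_one_add_pow_sub_map hp ?_) b)
  · rw [laurentFrobenius_single, single_pow, expand_X, nsmul_eq_mul]
  · rw [laurentFrobenius_single, single_pow, map_one, one_pow, nsmul_eq_mul]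

theorem blockProd_chooseLaurent (p : ℕ) (α β : ℕ → ℕ) (i c : ℕ) :
    blockProd p (laurentFrobenius p) (fun j => chooseLaurent (α j) (β j)) i c =
      (1 + single ((p ^ i : ℕ) : ℤ) (X ^ p ^ i)) ^ (∑ j ∈ Finset.Ico i c, α j * p ^ (j - i)) *
      (1 + single (-((p ^ i : ℕ) : ℤ)) 1) ^ (∑ j ∈ Finset.Ico i c, β j * p ^ (j - i)) := by
  rw [blockProd, ← Finset.prod_pow_eq_pow_sum, ← Finset.prod_pow_eq_pow_sum,
    ← Finset.prod_mul_distrib]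
  refine Finset.prod_congr rfl fun j _ => ?_
  rw [chooseLaurent, mul_pow, ← pow_mul, ← pow_mul, iterate_map_mul, iterate_map_pow,
    iterate_map_pow, iterate_map_add, iterate_map_add, iterate_map_one,
    laurentFrobenius_iterate_single, laurentFrobenius_iterate_single]
  simp

/-- This supplies the factorisation assumed in the abstract congruence: the block has t-exponents of
absolute value below p^c, while those of σ^c g are multiples of p^c. -/
theorem constantTerm_blockProd_mul {p : ℕ} (hp : 0 < p) {α β : ℕ → ℕ} {i c : ℕ} (hi : i ≤ c)
    (hα : ∑ j ∈ Finset.Ico i c, α j * p ^ (j - i) < p ^ (c - i))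
    (hβ : ∑ j ∈ Finset.Ico i c, β j * p ^ (j - i) < p ^ (c - i)) (g : AddMonoidAlgebra ℤ[X] ℤ) :
    laurentConstantTerm (blockProd p (laurentFrobenius p)
      (fun j => chooseLaurent (α j) (β j)) i c * (laurentFrobenius p)^[c] g) =
    expand ℤ (p ^ i) (choosePoly (∑ j ∈ Finset.Ico i c, α j * p ^ (j - i))
      (∑ j ∈ Finset.Ico i c, β j * p ^ (j - i))) *
      (expand ℤ p : ℤ[X] →+* ℤ[X])^[c] (laurentConstantTerm g) := by
  induction g using AddMonoidAlgebra.induction_linear with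
  | zero => rw [iterate_map_zero, mul_zero, map_zero, iterate_map_zero, mul_zero]
  | add f g hf hg =>
    rw [iterate_map_add, mul_add, map_add, hf, hg, map_add, iterate_map_add, mul_add]
  | single m r =>
    rw [laurentFrobenius_iterate_single, blockProd_chooseLaurent, expand_choosePoly]
    have e : (p : ℤ) ^ c * m = ((p ^ i : ℕ) : ℤ) * ((p ^ (c - i) : ℕ) : ℤ) * m := by
      rw [← Nat.cast_mul, ← pow_add, Nat.add_sub_cancel' hi, Nat.cast_pow]
    have h := coeff_zero_one_add_pow_mul (R := ℤ[X]) (pow_pos hp i) hα hβ (X ^ p ^ i)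
      (expand ℤ (p ^ c) r) m
    rw [e]
    change AddMonoidAlgebra.coeff _ 0 = _ * (expand ℤ p : ℤ[X] →+* ℤ[X])^[c]
      ((single m r : AddMonoidAlgebra ℤ[X] ℤ).coeff 0)
    rw [h, coeff_single, Finsupp.single_apply]
    split_ifs with hm
    · rw [expand_pow]
      rfl
    · rw [iterate_map_zero, mul_zero]

theorem constantTerm_blockProd {p : ℕ} (hp : 0 < p) {α β : ℕ → ℕ} {i c : ℕ} (hi : i ≤ c)
    (hα : ∑ j ∈ Finset.Ico i c, α j * p ^ (j - i) < p ^ (c - i))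
    (hβ : ∑ j ∈ Finset.Ico i c, β j * p ^ (j - i) < p ^ (c - i)) :
    laurentConstantTerm (blockProd p (laurentFrobenius p)
      (fun j => chooseLaurent (α j) (β j)) i c) =
    expand ℤ (p ^ i) (choosePoly (∑ j ∈ Finset.Ico i c, α j * p ^ (j - i))
      (∑ j ∈ Finset.Ico i c, β j * p ^ (j - i))) := by
  have h := constantTerm_blockProd_mul hp hi hα hβ 1
  have h1 : laurentConstantTerm 1 = 1 := by
    change (1 : AddMonoidAlgebra ℤ[X] ℤ).coeff 0 = 1
    rw [AddMonoidAlgebra.coeff_one_zero]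
  rwa [iterate_map_one, mul_one, h1, iterate_map_one, mul_one] at h

/-- Dwork congruences for the polynomials `∑ₖ C(a,k) C(b,k) Xᵏ` attached to digit sequences. -/
theorem dwork_congruence_choosePoly {p : ℕ} (hp : p.Prime) {α β : ℕ → ℕ}
    (hα : ∀ i c, i ≤ c → ∑ j ∈ Finset.Ico i c, α j * p ^ (j - i) < p ^ (c - i))
    (hβ : ∀ i c, i ≤ c → ∑ j ∈ Finset.Ico i c, β j * p ^ (j - i) < p ^ (c - i))
    {Q : ℕ → ℕ → ℤ[X]} (hQ : ∀ i c, Q i c = choosePoly (∑ j ∈ Finset.Ico i c, α j * p ^ (j - i))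
      (∑ j ∈ Finset.Ico i c, β j * p ^ (j - i))) {c s : ℕ} (hc : 1 ≤ c) (hs : c ≤ s) :
    (p : ℤ[X]) ^ c ∣ Q 0 c * expand ℤ p (Q 1 s) - Q 0 s * expand ℤ p (Q 1 c) := by
  have key := fun i c hi => constantTerm_blockProd hp.pos hi (hα i c hi) (hβ i c hi)
  have h := dwork_congruence_constantTerm (τ := (expand ℤ p : ℤ[X] →+* ℤ[X]))
    (ct := laurentConstantTerm) (fun j => natCast_dvd_chooseLaurent_pow_sub hp (α j) (β j))
    (fun i c g hi => by
      rw [key i c hi]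
      exact constantTerm_blockProd_mul hp.pos hi (hα i c hi) (hβ i c hi) g) s c hc hs
  rw [key 0 c (by omega), key 1 s (by omega), key 0 s (by omega), key 1 c (by omega), ← hQ, ← hQ,
    ← hQ, ← hQ] at h
  simpa using h

end LaurentFrobenius

/-! ### Digits of -1/3 and -2/3 -/

section Digits

open Polynomial

theorem padicTrunc_neg_div_three {p : ℕ} [Fact p.Prime] (hp : 3 < p) (g : ℕ) {s n : ℕ}
    (hn : n < p ^ s) (hd : p ^ s ∣ 3 * n + g) : padicTrunc p (-(g : ℚ) / 3) s = n := by
  have hpp : p.Prime := Fact.out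
  have hcop : Nat.Coprime p 3 := (Nat.coprime_primes hpp Nat.prime_three).2 (by omega)
  have h3 : ‖(3 : ℚ_[p])‖ = 1 := by
    have := (Padic.norm_natCast_eq_one_iff (p := p) (n := 3)).2 hcop
    exact_mod_cast this
  have hle : ‖((-(g : ℚ) / 3 : ℚ) : ℚ_[p])‖ ≤ 1 := by
    push_cast
    rw [norm_div, norm_neg, h3, div_one]
    simpa using Padic.norm_int_le_one (p := p) g
  rw [padicTrunc, dif_pos hle]
  set x : ℤ_[p] := ⟨((-(g : ℚ) / 3 : ℚ) : ℚ_[p]), hle⟩ with hx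
  have hx3 : 3 * x = -(g : ℤ_[p]) := by
    apply PadicInt.ext
    have h3' : ((3 : ℤ_[p]) : ℚ_[p]) = 3 := rfl
    rw [PadicInt.coe_mul, PadicInt.coe_neg, PadicInt.coe_natCast, h3']
    change 3 * ((-(g : ℚ) / 3 : ℚ) : ℚ_[p]) = _
    push_cast
    ring
  have hspec := Ideal.mem_span_singleton.1 (PadicInt.appr_spec s x)
  have h1 : (p : ℤ_[p]) ^ s ∣ ((3 * (n : ℤ) - 3 * (x.appr s : ℤ) : ℤ) : ℤ_[p]) := by
    have h2 : (p : ℤ_[p]) ^ s ∣ ((3 * n + g : ℕ) : ℤ_[p]) := by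
      exact_mod_cast Nat.cast_dvd_cast (α := ℤ_[p]) hd
    have h3 := dvd_add h2 (hspec.mul_left 3)
    convert h3 using 1
    push_cast
    linear_combination -hx3
  rw [PadicInt.pow_p_dvd_int_iff, ← mul_sub] at h1
  have hcop' := Nat.isCoprime_iff_coprime.2 (Nat.Coprime.pow_left s hcop)
  have h4 : ((p ^ s : ℕ) : ℤ) ∣ (n : ℤ) - (x.appr s : ℤ) :=
    hcop'.dvd_of_dvd_mul_left (by push_cast at h1 ⊢; exact h1)
  exact (Nat.modEq_iff_dvd.2 h4).eq_of_lt_of_lt (PadicInt.appr_lt x s) hn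

/-- The hypothesis says -γ_j/3 = β_j + p(-γ_{j+1}/3), so β_j is a digit and γ records the successive
tails; the sum telescopes. -/
theorem sum_digit_mul_pow {p : ℕ} {γ β : ℕ → ℕ} (h : ∀ j, 3 * β j + γ j = γ (j + 1) * p) {i c : ℕ}
    (hi : i ≤ c) :
    3 * ∑ j ∈ Finset.Ico i c, β j * p ^ (j - i) + γ i = γ c * p ^ (c - i) := by
  induction c, hi using Nat.le_induction with
  | base => simp
  | succ c hi ih =>
    rw [Finset.sum_Ico_succ_top hi, mul_add, Nat.succ_sub hi, pow_succ',
      ← mul_assoc (γ (c + 1)), ← h c]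
    linarith

theorem sum_digit_lt {p : ℕ} {γ β : ℕ → ℕ} (hp : 0 < p) (hγ : ∀ j, γ j ≤ 2)
    (h : ∀ j, 3 * β j + γ j = γ (j + 1) * p) {i c : ℕ}
    (hi : i ≤ c) : ∑ j ∈ Finset.Ico i c, β j * p ^ (j - i) < p ^ (c - i) := by
  have h1 := sum_digit_mul_pow h hi
  have h2 : γ c * p ^ (c - i) ≤ 2 * p ^ (c - i) := by gcongr; exact hγ c
  have h3 : 0 < p ^ (c - i) := by positivity
  omega

theorem sum_digit_eq_padicTrunc {p : ℕ} [Fact p.Prime] (hp : 3 < p) {γ β : ℕ → ℕ}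
    (hγ : ∀ j, γ j ≤ 2) (h : ∀ j, 3 * β j + γ j = γ (j + 1) * p) {i c : ℕ} (hi : i ≤ c) :
    ∑ j ∈ Finset.Ico i c, β j * p ^ (j - i) = padicTrunc p (-(γ i : ℚ) / 3) (c - i) :=
  (padicTrunc_neg_div_three hp _ (sum_digit_lt (by omega) hγ h hi)
    ⟨γ c, by rw [sum_digit_mul_pow h hi, mul_comm]⟩).symm

/-- The integral model of `Qbar`. -/
noncomputable def intQbar (p : ℕ) [Fact p.Prime] (s : ℕ) : ℤ[X] :=
  choosePoly (padicTrunc p (-2 / 3) s) (padicTrunc p (-1 / 3) s)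

theorem dwork_congruence_intQbar {p : ℕ} [Fact p.Prime] (hp : 3 < p) {c s : ℕ} (hs : c ≤ s) :
    (p : ℤ[X]) ^ (c + 1) ∣ intQbar p (c + 1) * expand ℤ p (intQbar p s) -
      intQbar p (s + 1) * expand ℤ p (intQbar p c) := by
  have hpp : p.Prime := Fact.out
  have hp3 : p % 3 = 1 ∨ p % 3 = 2 := by
    have : p % 3 ≠ 0 := fun h0 => by
      have := (Nat.prime_dvd_prime_iff_eq Nat.prime_three hpp).1 (Nat.dvd_of_mod_eq_zero h0)
      omega
    omega
  -- Since p² ≡ 1 mod 3, γ_{j+1} p ≡ γ_j mod 3, so γ governs the digits of -1/3 and 3 - γ those of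
  -- -2/3.
  set γ : ℕ → ℕ := fun j => p ^ j % 3 with hγdef
  have hstep : ∀ j, γ (j + 1) = γ j * p % 3 := fun j => by
    simp [hγdef, pow_succ, Nat.mul_mod]
  have hγ : ∀ j, γ j = 1 ∨ γ j = 2 := by
    intro j
    induction j with
    | zero => left; simp [hγdef]
    | succ j ih =>
      rw [hstep, Nat.mul_mod]
      rcases ih with h | h <;> rcases hp3 with h' | h' <;> simp [h, h']
  have hγp : ∀ j, γ (j + 1) * p % 3 = γ j := by
    intro j
    rw [hstep, Nat.mul_mod, Nat.mod_mod, Nat.mul_mod (γ j)]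
    rcases hγ j with h | h <;> rcases hp3 with h' | h' <;> simp [h, h']
  have hβ : ∀ j, 3 * (γ (j + 1) * p / 3) + γ j = γ (j + 1) * p := fun j => by
    have := hγp j
    omega
  have hα : ∀ j, 3 * ((3 - γ (j + 1)) * p / 3) + (3 - γ j) = (3 - γ (j + 1)) * p := fun j => by
    have := hγp j
    rcases hγ j with h | h <;> rcases hγ (j + 1) with h' | h' <;> simp only [h, h'] at this ⊢ <;> omega
  have hγ2 : ∀ j, γ j ≤ 2 := fun j => by rcases hγ j with h | h <;> omega
  have hγ2' : ∀ j, 3 - γ j ≤ 2 := fun j => by rcases hγ j with h | h <;> omega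
  have hQ : ∀ i c, i ≤ c → choosePoly
      (∑ j ∈ Finset.Ico i c, ((3 - γ (j + 1)) * p / 3) * p ^ (j - i))
      (∑ j ∈ Finset.Ico i c, (γ (j + 1) * p / 3) * p ^ (j - i)) = intQbar p (c - i) := by
    intro i c hi
    rw [sum_digit_eq_padicTrunc hp hγ2 hβ hi,
      sum_digit_eq_padicTrunc (γ := fun j => 3 - γ j) hp hγ2' hα hi, intQbar]
    -- If γ_i = 2 the two tails are interchanged, which the symmetry of `choosePoly` absorbs.
    rcases hγ i with h | h <;> simp only [h]
    · norm_num
    · rw [choosePoly_comm]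
      norm_num
  have h := dwork_congruence_choosePoly hpp
    (fun i c hi => sum_digit_lt (γ := fun j => 3 - γ j) hpp.pos hγ2' hα hi)
    (fun i c hi => sum_digit_lt hpp.pos hγ2 hβ hi) (fun _ _ => rfl)
    (show 1 ≤ c + 1 by omega) (show c + 1 ≤ s + 1 by omega)
  rw [hQ 0 _ (by omega), hQ 1 _ (by omega), hQ 0 _ (by omega), hQ 1 _ (by omega)] at h
  simpa using h

end Digits

/-! ### Units, ratios and uniform convergence over ℤ_p -/

section PadicModel

open Polynomial

theorem ordinaryHypergeometricCoefficient_neg_nat (p : ℕ) [Fact p.Prime] (m n k : ℕ) :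
    ordinaryHypergeometricCoefficient (-(m : ℚ_[p])) (-(n : ℚ_[p])) 1 k =
      ((m.choose k * n.choose k : ℕ) : ℚ_[p]) := by
  have hk : (k.factorial : ℚ_[p]) ≠ 0 := Nat.cast_ne_zero.2 k.factorial_ne_zero
  rw [ordinaryHypergeometricCoefficient, ascPochhammer_eval_neg_eq_descPochhammer,
    ascPochhammer_eval_neg_eq_descPochhammer, descPochhammer_eval_eq_descFactorial,
    descPochhammer_eval_eq_descFactorial, ascPochhammer_eval_one,
    Nat.descFactorial_eq_factorial_mul_choose, Nat.descFactorial_eq_factorial_mul_choose]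
  have h1 : ((-1 : ℚ_[p]) ^ k) * (-1) ^ k = 1 := by rw [← mul_pow]; simp
  push_cast
  field_simp
  linear_combination (m.choose k * n.choose k : ℚ_[p]) * h1

theorem Qbar_eq_map (p : ℕ) [Fact p.Prime] (s : ℕ) :
    Qbar p s = (intQbar p s).map (Int.castRingHom ℚ_[p]) := by
  rw [Qbar, hypergeometricPoly, intQbar, choosePoly, Polynomial.map_sum]
  refine Finset.sum_congr rfl fun k _ => ?_
  rw [ordinaryHypergeometricCoefficient_neg_nat]
  simp

/-- The model of `Qbar` over the `p`-adic integers. -/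
noncomputable def padicQbar (p : ℕ) [Fact p.Prime] (s : ℕ) : ℤ_[p][X] :=
  (intQbar p s).map (Int.castRingHom ℤ_[p])

theorem Qbar_eval_coe (p : ℕ) [Fact p.Prime] (s : ℕ) (z : ℤ_[p]) :
    (Qbar p s).eval (z : ℚ_[p]) = ((padicQbar p s).eval z : ℤ_[p]) := by
  have h : Qbar p s = (padicQbar p s).map PadicInt.Coe.ringHom := by
    rw [Qbar_eq_map, padicQbar, Polynomial.map_map]
    congr 1
  rw [h]
  exact Polynomial.eval_map_apply PadicInt.Coe.ringHom z

theorem dwork_congruence_padicQbar {p : ℕ} [Fact p.Prime] (hp : 3 < p) {c s : ℕ} (hs : c ≤ s) :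
    (p : ℤ_[p][X]) ^ (c + 1) ∣ padicQbar p (c + 1) * expand ℤ_[p] p (padicQbar p s) -
      padicQbar p (s + 1) * expand ℤ_[p] p (padicQbar p c) := by
  have h := map_dvd (mapRingHom (Int.castRingHom ℤ_[p])) (dwork_congruence_intQbar hp hs)
  have hp0 : p ≠ 0 := by omega
  simpa [padicQbar, Polynomial.map_expand] using h

theorem dwork_congruence_padicQbar_eval {p : ℕ} [Fact p.Prime] (hp : 3 < p) {c s : ℕ}
    (hs : c ≤ s) (z : ℤ_[p]) :
    (p : ℤ_[p]) ^ (c + 1) ∣ (padicQbar p (c + 1)).eval z * (padicQbar p s).eval (z ^ p) -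
      (padicQbar p (s + 1)).eval z * (padicQbar p c).eval (z ^ p) := by
  have h := map_dvd (evalRingHom z) (dwork_congruence_padicQbar hp hs)
  simpa [expand_eval] using h

theorem padicQbar_eval_zero (p : ℕ) [Fact p.Prime] (s : ℕ) : (padicQbar p s).eval 0 = 1 := by
  rw [← coeff_zero_eq_eval_zero, padicQbar, coeff_map, intQbar, choosePoly_coeff]
  simp

theorem padicQbar_zero (p : ℕ) [Fact p.Prime] : padicQbar p 0 = 1 := by
  have h : ∀ q : ℚ, padicTrunc p q 0 = 0 := fun q => by
    rw [padicTrunc]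
    split_ifs
    · rfl
    · rfl
  simp [padicQbar, intQbar, choosePoly, h]

theorem PadicInt.isUnit_of_dvd_sub {p : ℕ} [Fact p.Prime] {a b : ℤ_[p]} (ha : IsUnit a)
    (h : (p : ℤ_[p]) ∣ a - b) : IsUnit b := by
  rw [PadicInt.isUnit_iff] at ha ⊢
  by_contra hb
  have hb' := lt_of_le_of_ne (PadicInt.norm_le_one b) hb
  rw [PadicInt.norm_lt_one_iff_dvd] at hb'
  have := (PadicInt.norm_lt_one_iff_dvd a).2 (by simpa using dvd_add h hb')
  linarith

theorem PadicInt.dvd_pow_prime_sub (p : ℕ) [Fact p.Prime] (z : ℤ_[p]) :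
    (p : ℤ_[p]) ∣ z ^ p - z := by
  rw [← Ideal.mem_span_singleton, ← PadicInt.maximalIdeal_eq_span_p, ← PadicInt.ker_toZMod,
    RingHom.mem_ker, map_sub, map_pow, ZMod.pow_card, sub_self]

/-- As Q_0 = 1, the congruence with c = 0 reads Q_{s+1}(z) ≡ Q_1(z) Q_s(z^p) mod p; also Q_s(z^p) ≡
Q_s(z) mod p. -/
theorem padicQbar_eval_isUnit {p : ℕ} [Fact p.Prime] (hp : 3 < p) {z : ℤ_[p]}
    (hz : IsUnit ((padicQbar p 1).eval z)) (s : ℕ) :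
    IsUnit ((padicQbar p s).eval z) ∧ IsUnit ((padicQbar p s).eval (z ^ p)) := by
  have frob : ∀ s, IsUnit ((padicQbar p s).eval z) → IsUnit ((padicQbar p s).eval (z ^ p)) := by
    intro s h
    refine PadicInt.isUnit_of_dvd_sub h ?_
    refine dvd_trans ?_ (sub_dvd_eval_sub z (z ^ p) _)
    rw [← neg_sub, dvd_neg]
    exact PadicInt.dvd_pow_prime_sub p z
  induction s with
  | zero => simp [padicQbar_zero]
  | succ s ih =>
    have h := dwork_congruence_padicQbar_eval hp (Nat.zero_le s) z
    simp only [padicQbar_zero, eval_one, mul_one, zero_add, pow_one] at h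
    have h1 := PadicInt.isUnit_of_dvd_sub (hz.mul ih.2) h
    exact ⟨h1, frob _ h1⟩

theorem mem_domainD_iff {p : ℕ} [Fact p.Prime] {x : ℚ_[p]} :
    x ∈ domainD p ↔ ∃ z : ℤ_[p], (z : ℚ_[p]) = x ∧ IsUnit ((padicQbar p 1).eval z) := by
  constructor
  · rintro ⟨h1, h2⟩
    refine ⟨⟨x, h1⟩, rfl, ?_⟩
    have := Qbar_eval_coe p 1 ⟨x, h1⟩
    rw [PadicInt.isUnit_iff, PadicInt.norm_def, ← this]
    exact h2
  · rintro ⟨z, rfl, hz⟩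
    refine ⟨z.2, ?_⟩
    rw [Qbar_eval_coe, ← PadicInt.norm_def]
    exact PadicInt.isUnit_iff.1 hz

theorem isUnit_padicQbar_one_eval_add {p : ℕ} [Fact p.Prime] {a y : ℤ_[p]}
    (ha : IsUnit ((padicQbar p 1).eval a)) (hy : ‖y‖ < 1) :
    IsUnit ((padicQbar p 1).eval (a + y)) := by
  refine PadicInt.isUnit_of_dvd_sub ha (dvd_trans ?_ (sub_dvd_eval_sub a (a + y) _))
  rw [sub_add_cancel_left, dvd_neg]
  exact (PadicInt.norm_lt_one_iff_dvd y).1 hy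

theorem exists_eq_add_of_mem_ball {p : ℕ} [Fact p.Prime] {a : ℤ_[p]} {x : ℚ_[p]}
    (hx : x ∈ Metric.ball (a : ℚ_[p]) 1) : ∃ y : ℤ_[p], ‖y‖ < 1 ∧ ((a + y : ℤ_[p]) : ℚ_[p]) = x := by
  rw [Metric.mem_ball, dist_eq_norm] at hx
  exact ⟨⟨x - a, hx.le⟩, hx, add_sub_cancel (a : ℚ_[p]) x⟩

theorem ball_subset_domainD {p : ℕ} [Fact p.Prime] {a : ℚ_[p]} (ha : a ∈ domainD p) :
    Metric.ball a 1 ⊆ domainD p := by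
  obtain ⟨z, rfl, hz⟩ := mem_domainD_iff.1 ha
  intro x hx
  obtain ⟨y, hy, rfl⟩ := exists_eq_add_of_mem_ball hx
  exact mem_domainD_iff.2 ⟨z + y, rfl, isUnit_padicQbar_one_eval_add hz hy⟩

theorem mem_domainD_of_norm_lt_one {p : ℕ} [Fact p.Prime] {x : ℚ_[p]} (hx : ‖x‖ < 1) :
    x ∈ domainD p :=
  ball_subset_domainD (mem_domainD_iff.2 ⟨0, rfl, by rw [padicQbar_eval_zero]; exact isUnit_one⟩)
    (by simpa using hx)

theorem norm_Qbar_eval {p : ℕ} [Fact p.Prime] (hp : 3 < p) {x : ℚ_[p]} (hx : x ∈ domainD p)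
    (s : ℕ) : ‖(Qbar p s).eval x‖ = 1 ∧ ‖(Qbar p s).eval (x ^ p)‖ = 1 := by
  obtain ⟨z, rfl, hz⟩ := mem_domainD_iff.1 hx
  rw [← PadicInt.coe_pow, Qbar_eval_coe, Qbar_eval_coe, ← PadicInt.norm_def, ← PadicInt.norm_def]
  exact ⟨PadicInt.isUnit_iff.1 (padicQbar_eval_isUnit hp hz s).1,
    PadicInt.isUnit_iff.1 (padicQbar_eval_isUnit hp hz s).2⟩

theorem Qbar_eval_pow_ne_zero {p : ℕ} [Fact p.Prime] (hp : 3 < p) {x : ℚ_[p]}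
    (hx : x ∈ domainD p) (s : ℕ) : (Qbar p s).eval (x ^ p) ≠ 0 := by
  rw [← norm_ne_zero_iff, (norm_Qbar_eval hp hx s).2]
  exact one_ne_zero

theorem PadicInt.norm_le_inv_pow_of_dvd {p : ℕ} [Fact p.Prime] {n : ℕ} {x : ℤ_[p]}
    (h : (p : ℤ_[p]) ^ n ∣ x) : ‖x‖ ≤ ((p : ℝ)⁻¹) ^ n := by
  have := (PadicInt.norm_le_pow_iff_mem_span_pow x n).2 (Ideal.mem_span_singleton.2 h)
  simpa using this

/-- Both denominators have norm 1, so the bound is the Dwork congruence for the cross-multiplied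
numerator. -/
theorem norm_Qbar_ratio_sub_le {p : ℕ} [Fact p.Prime] (hp : 3 < p) {x : ℚ_[p]}
    (hx : x ∈ domainD p) {c s : ℕ} (hs : c ≤ s) :
    ‖(Qbar p (c + 1)).eval x / (Qbar p c).eval (x ^ p) -
      (Qbar p (s + 1)).eval x / (Qbar p s).eval (x ^ p)‖ ≤ ((p : ℝ)⁻¹) ^ (c + 1) := by
  rw [div_sub_div _ _ (Qbar_eval_pow_ne_zero hp hx c) (Qbar_eval_pow_ne_zero hp hx s), norm_div,
    norm_mul, (norm_Qbar_eval hp hx c).2, (norm_Qbar_eval hp hx s).2, mul_one, div_one]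
  obtain ⟨z, rfl, hz⟩ := mem_domainD_iff.1 hx
  have h := PadicInt.norm_le_inv_pow_of_dvd (dwork_congruence_padicQbar_eval hp hs z)
  rw [← PadicInt.coe_pow]
  simp only [Qbar_eval_coe]
  rw [← PadicInt.coe_mul, ← PadicInt.coe_mul, ← PadicInt.coe_sub, ← PadicInt.norm_def, mul_comm
    ((padicQbar p c).eval (z ^ p))]
  exact h

theorem tendsto_inv_prime_pow (p : ℕ) [Fact p.Prime] :
    Filter.Tendsto (fun n : ℕ => ((p : ℝ)⁻¹) ^ (n + 1)) Filter.atTop (nhds 0) := by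
  have hp : 1 < (p : ℝ) := by exact_mod_cast (Fact.out : p.Prime).one_lt
  exact (tendsto_pow_atTop_nhds_zero_of_lt_one (by positivity)
    (inv_lt_one_of_one_lt₀ hp)).comp (Filter.tendsto_add_atTop_nat 1)

/-- The ratios `Q̄_{s+1}(x) / Q̄_s(xᵖ)` converge uniformly on `domainD p`. -/
theorem exists_tendstoUniformlyOn_Qbar_ratio {p : ℕ} [Fact p.Prime] (hp : 3 < p) :
    ∃ f : ℚ_[p] → ℚ_[p], TendstoUniformlyOn
      (fun (s : ℕ) (x : ℚ_[p]) => (Qbar p (s + 1)).eval x / (Qbar p s).eval (x ^ p))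
      f Filter.atTop (domainD p) := by
  have key : ∀ x ∈ domainD p, ∀ n m N : ℕ, N ≤ n → N ≤ m →
      dist ((Qbar p (n + 1)).eval x / (Qbar p n).eval (x ^ p))
        ((Qbar p (m + 1)).eval x / (Qbar p m).eval (x ^ p)) ≤ 2 * ((p : ℝ)⁻¹) ^ (N + 1) := by
    intro x hx n m N hn hm
    refine (dist_triangle_left _ _
      ((Qbar p (N + 1)).eval x / (Qbar p N).eval (x ^ p))).trans ?_
    rw [two_mul, dist_eq_norm, dist_eq_norm]
    exact add_le_add (norm_Qbar_ratio_sub_le hp hx hn) (norm_Qbar_ratio_sub_le hp hx hm)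
  have hlim : Filter.Tendsto (fun n : ℕ => 2 * ((p : ℝ)⁻¹) ^ (n + 1)) Filter.atTop (nhds 0) := by
    simpa using (tendsto_inv_prime_pow p).const_mul 2
  have hpt : ∀ x ∈ domainD p, ∃ l, Filter.Tendsto
      (fun s : ℕ => (Qbar p (s + 1)).eval x / (Qbar p s).eval (x ^ p)) Filter.atTop (nhds l) :=
    fun x hx => cauchySeq_tendsto_of_complete (cauchySeq_of_le_tendsto_0 _ (key x hx) hlim)
  choose! f hf using hpt
  refine ⟨f, UniformCauchySeqOn.tendstoUniformlyOn_of_tendsto ?_ hf⟩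
  rw [Metric.uniformCauchySeqOn_iff]
  intro ε hε
  obtain ⟨N, hN⟩ := (hlim.eventually (gt_mem_nhds hε)).exists
  exact ⟨N, fun m hm n hn x hx => (key x hx m n N hm hn).trans_lt hN⟩

end PadicModel

/-! ### Evaluation and limits of power series over ℤ_p -/

section PowerSeriesEval

open PowerSeries

theorem PadicInt.summable_norm_coeff_mul_pow {p : ℕ} [Fact p.Prime] (g : ℕ → ℤ_[p]) {y : ℤ_[p]}
    (hy : ‖y‖ < 1) : Summable fun n => ‖g n * y ^ n‖ := by
  refine Summable.of_nonneg_of_le (fun _ => norm_nonneg _) (fun n => ?_)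
    (summable_geometric_of_lt_one (norm_nonneg y) hy)
  rw [norm_mul, norm_pow]
  exact mul_le_of_le_one_left (by positivity) (PadicInt.norm_le_one _)

/-- The value at `y` of a power series with `p`-adic integer coefficients. -/
noncomputable def padicSeriesEval {p : ℕ} [Fact p.Prime] (y : ℤ_[p]) (f : ℤ_[p]⟦X⟧) : ℤ_[p] :=
  ∑' n, coeff n f * y ^ n

theorem padicSeriesEval_mul {p : ℕ} [Fact p.Prime] {y : ℤ_[p]} (hy : ‖y‖ < 1) (f g : ℤ_[p]⟦X⟧) :
    padicSeriesEval y (f * g) = padicSeriesEval y f * padicSeriesEval y g := by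
  rw [padicSeriesEval, padicSeriesEval, padicSeriesEval,
    tsum_mul_tsum_eq_tsum_sum_antidiagonal_of_summable_norm
      (PadicInt.summable_norm_coeff_mul_pow _ hy) (PadicInt.summable_norm_coeff_mul_pow _ hy)]
  refine tsum_congr fun n => ?_
  rw [coeff_mul, Finset.sum_mul]
  refine Finset.sum_congr rfl fun ij hij => ?_
  rw [← Finset.HasAntidiagonal.mem_antidiagonal.1 hij, pow_add]
  ring

theorem padicSeriesEval_coe {p : ℕ} [Fact p.Prime] (y : ℤ_[p]) (f : Polynomial ℤ_[p]) :
    padicSeriesEval y (f : ℤ_[p]⟦X⟧) = f.eval y := by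
  rw [padicSeriesEval, Polynomial.eval_eq_sum_range, tsum_eq_sum (s := Finset.range (f.natDegree + 1))]
  · simp
  · intro n hn
    rw [Polynomial.coeff_coe, Polynomial.coeff_eq_zero_of_natDegree_lt (by simpa using hn),
      zero_mul]

theorem tendsto_padicSeriesEval {p : ℕ} [Fact p.Prime] {y : ℤ_[p]} (hy : ‖y‖ < 1)
    {u : ℕ → ℤ_[p]⟦X⟧} {g : ℤ_[p]⟦X⟧}
    (h : ∀ n, Filter.Tendsto (fun s => coeff n (u s)) Filter.atTop (nhds (coeff n g))) :
    Filter.Tendsto (fun s => padicSeriesEval y (u s)) Filter.atTop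
      (nhds (padicSeriesEval y g)) := by
  refine tendsto_tsum_of_dominated_convergence (bound := fun n => ‖y‖ ^ n)
    (summable_geometric_of_lt_one (norm_nonneg y) hy) (fun n => (h n).mul_const _)
    (Filter.Eventually.of_forall fun s n => ?_)
  rw [norm_mul, norm_pow]
  exact mul_le_of_le_one_left (by positivity) (PadicInt.norm_le_one _)

theorem dvd_coeff_of_natCast_pow_dvd {p : ℕ} [Fact p.Prime] {k : ℕ} {f : ℤ_[p]⟦X⟧}
    (h : (p : ℤ_[p]⟦X⟧) ^ k ∣ f) (n : ℕ) : (p : ℤ_[p]) ^ k ∣ coeff n f := by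
  obtain ⟨g, rfl⟩ := h
  exact natCast_pow_dvd_map p k (coeff (R := ℤ_[p]) n).toAddMonoidHom g

theorem exists_coeff_limit {p : ℕ} [Fact p.Prime] {u : ℕ → ℤ_[p]⟦X⟧}
    (hu : ∀ c s, c ≤ s → (p : ℤ_[p]⟦X⟧) ^ (c + 1) ∣ u c - u s) :
    ∃ g : ℤ_[p]⟦X⟧, ∀ n,
      Filter.Tendsto (fun s => coeff n (u s)) Filter.atTop (nhds (coeff n g)) := by
  have hlim : Filter.Tendsto (fun n : ℕ => 2 * ((p : ℝ)⁻¹) ^ (n + 1)) Filter.atTop (nhds 0) := by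
    simpa using (tendsto_inv_prime_pow p).const_mul 2
  have hle : ∀ n c s, c ≤ s → dist (coeff n (u c)) (coeff n (u s)) ≤ ((p : ℝ)⁻¹) ^ (c + 1) := by
    intro n c s h
    rw [dist_eq_norm, ← map_sub]
    exact PadicInt.norm_le_inv_pow_of_dvd (dvd_coeff_of_natCast_pow_dvd (hu c s h) n)
  have hpt : ∀ n, ∃ l, Filter.Tendsto (fun s => coeff n (u s)) Filter.atTop (nhds l) := by
    intro n
    refine cauchySeq_tendsto_of_complete (cauchySeq_of_le_tendsto_0 _ (fun i j N hi hj => ?_) hlim)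
    refine (dist_triangle_left _ _ (coeff n (u N))).trans ?_
    rw [two_mul]
    exact add_le_add (hle n N i hi) (hle n N j hj)
  choose g hg using hpt
  exact ⟨PowerSeries.mk g, fun n => by simpa using hg n⟩

theorem hasFPowerSeriesOnBall_of_padicSeriesEval {p : ℕ} [Fact p.Prime] {f : ℚ_[p] → ℚ_[p]}
    {a : ℤ_[p]} {g : ℤ_[p]⟦X⟧}
    (h : ∀ y : ℤ_[p], ‖y‖ < 1 → f ((a + y : ℤ_[p]) : ℚ_[p]) = (padicSeriesEval y g : ℤ_[p])) :
    HasFPowerSeriesOnBall f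
      (FormalMultilinearSeries.ofScalars ℚ_[p] fun n => ((coeff n g : ℤ_[p]) : ℚ_[p]))
      (a : ℚ_[p]) 1 where
  r_le := by
    rw [← ENNReal.coe_one]
    refine FormalMultilinearSeries.le_radius_of_bound _ 1 fun n => ?_
    rw [FormalMultilinearSeries.ofScalars_norm]
    simpa using PadicInt.norm_le_one (coeff n g)
  r_pos := one_pos
  hasSum := by
    intro y hy
    have hy' : ‖y‖ < 1 := by
      have h1 : ‖y‖ₑ < 1 := by simpa using hy
      rw [← ENNReal.coe_one, enorm_lt_coe] at h1
      exact_mod_cast h1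
    have hs := (PadicInt.summable_norm_coeff_mul_pow (fun n => coeff n g)
      (y := ⟨y, hy'.le⟩) hy').of_norm.hasSum
    have hs' := hs.map (PadicInt.Coe.ringHom (p := p)) continuous_subtype_val
    have e := h ⟨y, hy'.le⟩ hy'
    simp only [FormalMultilinearSeries.ofScalars_apply_eq, smul_eq_mul]
    change f ((a : ℚ_[p]) + y) = _ at e
    rw [e]
    exact hs'

end PowerSeriesEval

/-! ### Analyticity of the limit -/

section LocalExpansion

open Polynomial

/-- Around each point of `domainD p` the ratios are power series with integral coefficients,
whose coefficients converge. -/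
theorem exists_series_of_ratio {p : ℕ} [Fact p.Prime] (hp : 3 < p) {a : ℤ_[p]}
    (ha : IsUnit ((padicQbar p 1).eval a)) :
    ∃ (u : ℕ → PowerSeries ℤ_[p]),
      (∀ c s, c ≤ s → (p : PowerSeries ℤ_[p]) ^ (c + 1) ∣ u c - u s) ∧
      ∀ y : ℤ_[p], ‖y‖ < 1 → ∀ s, (padicQbar p s).eval ((a + y) ^ p) * padicSeriesEval y (u s) =
        (padicQbar p (s + 1)).eval (a + y) := by
  set M : ℕ → PowerSeries ℤ_[p] := fun s =>
    (((expand ℤ_[p] p (padicQbar p s)).comp (X + C a) : ℤ_[p][X]) : PowerSeries ℤ_[p]) with hM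
  set N : ℕ → PowerSeries ℤ_[p] := fun s =>
    (((padicQbar p (s + 1)).comp (X + C a) : ℤ_[p][X]) : PowerSeries ℤ_[p]) with hN
  -- The constant coefficient is Q_s(a^p), a unit, so the division can be done in the power series
  -- ring over ℤ_p.
  have hMu : ∀ s, IsUnit (M s) := by
    intro s
    rw [PowerSeries.isUnit_iff_constantCoeff, hM]
    simp only [Polynomial.constantCoeff_coe]
    rw [coeff_zero_eq_eval_zero, eval_comp, expand_eval]
    simpa using (padicQbar_eval_isUnit hp ha s).2
  have hex : ∀ s, ∃ u, M s * u = N s := fun s => (hMu s).dvd.imp fun _ h => h.symm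
  choose u hu using hex
  refine ⟨u, fun c s hcs => ?_, fun y hy s => ?_⟩
  · rw [← ((hMu c).mul (hMu s)).dvd_mul_left]
    have e : M c * M s * (u c - u s) = N c * M s - N s * M c := by
      rw [← hu c, ← hu s]; ring
    rw [e]
    have h := map_dvd (Polynomial.coeToPowerSeries.ringHom (R := ℤ_[p]))
      (map_dvd (compRingHom (X + C a)) (dwork_congruence_padicQbar hp hcs))
    rw [map_pow, map_natCast, map_pow, map_natCast] at h
    simpa [hM, hN] using h
  · have h := congrArg (padicSeriesEval y) (hu s)
    rw [padicSeriesEval_mul hy, hM, hN] at h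
    simp only [padicSeriesEval_coe, eval_comp, expand_eval, eval_add, eval_X, eval_C] at h
    rwa [add_comm y a] at h

theorem exists_hasFPowerSeriesOnBall_of_tendsto {p : ℕ} [Fact p.Prime] (hp : 3 < p)
    {f : ℚ_[p] → ℚ_[p]}
    (hf : ∀ x ∈ domainD p, Filter.Tendsto
      (fun s : ℕ => (Qbar p (s + 1)).eval x / (Qbar p s).eval (x ^ p)) Filter.atTop (nhds (f x)))
    {a : ℚ_[p]} (ha : a ∈ domainD p) :
    ∃ P : FormalMultilinearSeries ℚ_[p] ℚ_[p] ℚ_[p], HasFPowerSeriesOnBall f P a 1 := by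
  obtain ⟨z, rfl, hz⟩ := mem_domainD_iff.1 ha
  obtain ⟨u, hu, hev⟩ := exists_series_of_ratio hp hz
  obtain ⟨g, hg⟩ := exists_coeff_limit hu
  refine ⟨_, hasFPowerSeriesOnBall_of_padicSeriesEval (g := g) fun y hy => ?_⟩
  have hmem : ((z + y : ℤ_[p]) : ℚ_[p]) ∈ domainD p :=
    mem_domainD_iff.2 ⟨z + y, rfl, isUnit_padicQbar_one_eval_add hz hy⟩
  have h1 : Filter.Tendsto (fun s => ((padicSeriesEval y (u s) : ℤ_[p]) : ℚ_[p])) Filter.atTop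
      (nhds ((padicSeriesEval y g : ℤ_[p]) : ℚ_[p])) :=
    (continuous_subtype_val.tendsto _).comp (tendsto_padicSeriesEval hy hg)
  refine tendsto_nhds_unique (hf _ hmem) (h1.congr fun s => ?_)
  rw [eq_div_iff (Qbar_eval_pow_ne_zero hp hmem s), ← PadicInt.coe_pow, Qbar_eval_coe,
    Qbar_eval_coe, ← hev y hy s, PadicInt.coe_mul, mul_comm]

end LocalExpansion

/-! ### Comparison with F on the open unit disc -/

section HypergeometricLimit

theorem tendsto_padicTrunc {p : ℕ} [Fact p.Prime] {q : ℚ} (hq : ‖(q : ℚ_[p])‖ ≤ 1) :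
    Filter.Tendsto (fun s => (padicTrunc p q s : ℚ_[p])) Filter.atTop (nhds (q : ℚ_[p])) := by
  rw [← Filter.tendsto_add_atTop_iff_nat 1, tendsto_iff_norm_sub_tendsto_zero]
  refine squeeze_zero (fun _ => norm_nonneg _) (fun s => ?_) (tendsto_inv_prime_pow p)
  rw [padicTrunc, dif_pos hq, norm_sub_rev]
  exact PadicInt.norm_le_inv_pow_of_dvd
    (Ideal.mem_span_singleton.1 (PadicInt.appr_spec (s + 1) ⟨(q : ℚ_[p]), hq⟩))

theorem padic_norm_intCast_div_three_le {p : ℕ} [Fact p.Prime] (hp : 3 < p) (g : ℤ) :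
    ‖(((g : ℚ) / 3 : ℚ) : ℚ_[p])‖ ≤ 1 := by
  have hcop : Nat.Coprime p 3 := (Nat.coprime_primes Fact.out Nat.prime_three).2 (by omega)
  have h3 : ‖(3 : ℚ_[p])‖ = 1 := by
    exact_mod_cast (Padic.norm_natCast_eq_one_iff (p := p) (n := 3)).2 hcop
  push_cast
  rw [norm_div, h3, div_one]
  exact Padic.norm_int_le_one g

theorem tendsto_hypergeometricCoefficient {p : ℕ} [Fact p.Prime] (hp : 3 < p) (k : ℕ) :
    Filter.Tendsto (fun s => ordinaryHypergeometricCoefficient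
      (-(padicTrunc p (-2 / 3) s : ℚ_[p])) (-(padicTrunc p (-1 / 3) s : ℚ_[p])) 1 k) Filter.atTop
      (nhds (ordinaryHypergeometricCoefficient (2 / 3 : ℚ_[p]) (1 / 3) 1 k)) := by
  have h2 := (tendsto_padicTrunc (by simpa using padic_norm_intCast_div_three_le hp (-2)) :
    Filter.Tendsto (fun s => (padicTrunc p (-2 / 3) s : ℚ_[p])) _ _).neg
  have h1 := (tendsto_padicTrunc (by simpa using padic_norm_intCast_div_three_le hp (-1)) :
    Filter.Tendsto (fun s => (padicTrunc p (-1 / 3) s : ℚ_[p])) _ _).neg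
  rw [show -((-2 / 3 : ℚ) : ℚ_[p]) = 2 / 3 by push_cast; ring] at h2
  rw [show -((-1 / 3 : ℚ) : ℚ_[p]) = 1 / 3 by push_cast; ring] at h1
  have hc := (ascPochhammer ℚ_[p] k).continuous
  exact (((hc.tendsto _).comp h2).const_mul _).mul ((hc.tendsto _).comp h1) |>.mul_const _

theorem norm_hypergeometricCoefficient_neg_nat_le (p : ℕ) [Fact p.Prime] (m n k : ℕ) :
    ‖ordinaryHypergeometricCoefficient (-(m : ℚ_[p])) (-(n : ℚ_[p])) 1 k‖ ≤ 1 := by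
  rw [ordinaryHypergeometricCoefficient_neg_nat]
  exact Padic.norm_int_le_one ((m.choose k * n.choose k : ℕ) : ℤ)

/-- The coefficient is a p-adic limit of products of integer binomials. -/
theorem norm_hypergeometricCoefficient_le {p : ℕ} [Fact p.Prime] (hp : 3 < p) (k : ℕ) :
    ‖ordinaryHypergeometricCoefficient (2 / 3 : ℚ_[p]) (1 / 3) 1 k‖ ≤ 1 :=
  le_of_tendsto (tendsto_hypergeometricCoefficient hp k).norm
    (Filter.Eventually.of_forall fun _ => norm_hypergeometricCoefficient_neg_nat_le p _ _ k)

theorem summable_hypergeometric {p : ℕ} [Fact p.Prime] (hp : 3 < p) {x : ℚ_[p]} (hx : ‖x‖ < 1) :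
    Summable (fun k : ℕ =>
      ordinaryHypergeometricCoefficient (2 / 3 : ℚ_[p]) (1 / 3) 1 k * x ^ k) := by
  refine Summable.of_norm_bounded (summable_geometric_of_lt_one (norm_nonneg x) hx) fun k => ?_
  rw [norm_mul, norm_pow]
  exact mul_le_of_le_one_left (by positivity) (norm_hypergeometricCoefficient_le hp k)

theorem tendsto_Qbar_eval_hyperF {p : ℕ} [Fact p.Prime] (hp : 3 < p) {x : ℚ_[p]}
    (hx : ‖x‖ < 1) :
    Filter.Tendsto (fun s => (Qbar p s).eval x) Filter.atTop (nhds (hyperF p x)) := by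
  simp only [Qbar, hypergeometricPoly_eval, hyperF, ordinaryHypergeometric,
    ordinaryHypergeometric_sum_eq]
  refine tendsto_tsum_of_dominated_convergence (bound := fun n => ‖x‖ ^ n)
    (summable_geometric_of_lt_one (norm_nonneg x) hx)
    (fun n => (tendsto_hypergeometricCoefficient hp n).smul_const _)
    (Filter.Eventually.of_forall fun s n => ?_)
  rw [norm_smul, norm_pow]
  exact mul_le_of_le_one_left (by positivity) (norm_hypergeometricCoefficient_neg_nat_le p _ _ n)

/-- F(x) is a limit of values Q_s(x) of norm 1, hence has norm 1. -/
theorem hyperF_ne_zero {p : ℕ} [Fact p.Prime] (hp : 3 < p) {x : ℚ_[p]} (hx : ‖x‖ < 1) :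
    hyperF p x ≠ 0 := by
  have h := (tendsto_Qbar_eval_hyperF hp hx).norm
  simp only [fun s => (norm_Qbar_eval hp (mem_domainD_of_norm_lt_one hx) s).1] at h
  rw [← norm_ne_zero_iff, ← tendsto_nhds_unique tendsto_const_nhds h]
  exact one_ne_zero

end HypergeometricLimit

theorem mainTheorem8 (p : ℕ) [Fact p.Prime] (hp : 3 < p) :
    -- each `Q̄_{s+1}(x) / Q̄_s(x^p)` is regular on `D`
    (∀ s : ℕ, 1 ≤ s → ∀ x ∈ domainD p, (Qbar p s).eval (x ^ p) ≠ 0) ∧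
    -- the series for `F` converges on the disc `|x| < 1`, which lies in `D`, and `F(x^p) ≠ 0` there
    (∀ x : ℚ_[p], ‖x‖ < 1 → x ∈ domainD p ∧
      Summable (fun k : ℕ =>
        ordinaryHypergeometricCoefficient (2 / 3 : ℚ_[p]) (1 / 3) 1 k * x ^ k) ∧
      hyperF p (x ^ p) ≠ 0) ∧
    ∃ f : ℚ_[p] → ℚ_[p],
      -- uniform convergence on `D`
      TendstoUniformlyOn
        (fun (s : ℕ) (x : ℚ_[p]) => (Qbar p (s + 1)).eval x / (Qbar p s).eval (x ^ p))
        f Filter.atTop (domainD p) ∧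
      -- the limit is analytic: a convergent power series on each disc `|x - a| < 1`, `a ∈ D`,
      -- and these discs lie in `D`
      (∀ a ∈ domainD p, Metric.ball a 1 ⊆ domainD p ∧
        ∃ P : FormalMultilinearSeries ℚ_[p] ℚ_[p] ℚ_[p], HasFPowerSeriesOnBall f P a 1) ∧
      -- the limit extends `F(x) / F(x^p)`
      (∀ x : ℚ_[p], ‖x‖ < 1 → f x = hyperF p x / hyperF p (x ^ p)) := by
  have hpow : ∀ x : ℚ_[p], ‖x‖ < 1 → ‖x ^ p‖ < 1 := fun x hx => by
    rw [norm_pow]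
    exact pow_lt_one₀ (norm_nonneg x) hx (by omega)
  refine ⟨fun s _ x hx => Qbar_eval_pow_ne_zero hp hx s, fun x hx =>
    ⟨mem_domainD_of_norm_lt_one hx, summable_hypergeometric hp hx,
      hyperF_ne_zero hp (hpow x hx)⟩, ?_⟩
  obtain ⟨f, hf⟩ := exists_tendstoUniformlyOn_Qbar_ratio hp
  refine ⟨f, hf, fun a ha => ⟨ball_subset_domainD ha,
    exists_hasFPowerSeriesOnBall_of_tendsto hp (fun x hx => hf.tendsto_at hx) ha⟩, fun x hx => ?_⟩
  exact tendsto_nhds_unique (hf.tendsto_at (mem_domainD_of_norm_lt_one hx))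
    (((tendsto_Qbar_eval_hyperF hp hx).comp (Filter.tendsto_add_atTop_nat 1)).div
      (tendsto_Qbar_eval_hyperF hp (hpow x hx)) (hyperF_ne_zero hp (hpow x hx)))
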